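/- **Setting.** Let $\mathcal T$ be a finite game tree whose root $s_0$ is a MAX node; every other internal node is a MAX or a MIN node, $\mathcal C(s)\neq\emptyset$ is the set of children of an internal node $s$, and $\mathcal L$ is the set of leaves. For $\mu=(\mu_\ell)_{\ell\in\mathcal L}\in[0,1]^{\mathcal L}$, the value of a leaf is $V_\ell(\mu)=\mu_\ell$, and $V_s(\mu)=\max_{c\in\mathcal C(s)}V_c(\mu)$ or $V_s(\mu)=\min_{c\in\mathcal C(s)}V_c(\mu)$ according to whether $s$ is a MAX or a MIN node. An action $s\in\mathcal C(s_0)$ is *best* under $\mu$ if $V_s(\mu)=V_{s_0}(\mu)$; if there is only one best action it is denoted by $s^*(\mu)$. Under the model $\mu$, an algorithm chooses at each round $t+1$ a leaf $L_{t+1}$ and observes $X_{t+1}\sim\mathrm{Bernoulli}(\mu_{L_{t+1}})$, drawn independently of the past given $L_{t+1}$. The choice of $L_{t+1}$, the decision to stop after $t$ samples and the recommendation $\hat s\in\mathcal C(s_0)$ made upon stopping depend only on $L_1,X_1,\dots,L_t,X_t$ and possibly on an independent random seed whose law does not depend on $\mu$. Let $\tau\in\{0,1,2,\dots\}\cup\{\infty\}$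 be the number of samples taken before stopping. The algorithm is *$\delta$-correct* (with accuracy $\epsilon=0$) if, for every $\lambda\in[0,1]^{\mathcal L}$ with a unique best action, $$\mathbb P_\lambda\big(\tau<\infty,\ V_{s_0}(\lambda)-V_{\hat s_\tau}(\lambda)\le 0\big)\ \ge\ 1-\delta .$$ **Theorem.** Let $0<\delta\le 1/2$. For every $\delta$-correct algorithm and every $\mu\in[0,1]^{\mathcal L}$ with a unique best action $s^*(\mu)$, $$\mathbb E_\mu[\tau]\ \ge\ T^*(\mu)\,d(\delta,1-\delta),\qquad\text{where}\qquad T^*(\mu)^{-1}:=\sup_{w\in\Sigma}\ \inf_{\lambda\in\mathrm{Alt}(\mu)}\ \sum_{\ell\in\mathcal L}w_\ell\, d(\mu_\ell,\lambda_\ell).$$ Here $\Sigma=\{w\in[0,1]^{\mathcal L}:\sum_\ell w_\ell=1\}$, $\mathrm{Alt}(\mu)=\{\lambda\in[0,1]^{\mathcal L}: s^*(\mu)\text{ is not a best action under }\lambda\}$, and $d(x,y)=x\ln\frac xy+(1-x)\ln\frac{1-x}{1-y}\in[0,\infty]$ is the binary Kullback–Leibler divergence (with $0\ln\frac0y=0$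 and $x\ln\frac x0=\infty$ for $x>0$). All quantities lie in $[0,\infty]$, with $0\cdot\infty=0$, $\inf\emptyset=\infty$, $1/0=\infty$ and $1/\infty=0$. -/

import Mathlib

open MeasureTheory ProbabilityTheory
open scoped ENNReal

/-- The two kinds of internal nodes: at a `max` node player A moves, at a `min` node player B. -/
inductive NodeKind where
  | max
  | min

/-- Finite game trees. An internal node is a MAX or a MIN node and has `n + 1 ≥ 1` children. -/
inductive GameTree where
  | leaf : GameTree
  | node (k : NodeKind) (n : ℕ) (child : Fin (n + 1) → GameTree) : GameTree

namespace GameTree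

/-- The set of leaves of a game tree. A leaf below an internal node is a pair formed by a child
of this node and a leaf below that child. -/
def Leaf : GameTree → Type
  | leaf => Unit
  | node _ n child => Σ i : Fin (n + 1), Leaf (child i)

instance instFintypeLeaf : (T : GameTree) → Fintype T.Leaf
  | leaf => inferInstanceAs (Fintype Unit)
  | node _ n child =>
    letI : ∀ i : Fin (n + 1), Fintype (child i).Leaf := fun i => instFintypeLeaf (child i)
    inferInstanceAs (Fintype (Σ i : Fin (n + 1), (child i).Leaf))

/-- The value of (the root of) a game tree whose leaves have the values `μ`: the maximum of the
values of the children at a MAX node, their minimum at a MIN node. -/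
noncomputable def value : (T : GameTree) → (T.Leaf → ℝ) → ℝ
  | leaf, μ => μ ()
  | node NodeKind.max _ child, μ =>
    Finset.univ.sup' Finset.univ_nonempty fun i => value (child i) fun l => μ ⟨i, l⟩
  | node NodeKind.min _ child, μ =>
    Finset.univ.inf' Finset.univ_nonempty fun i => value (child i) fun l => μ ⟨i, l⟩

/-- The game tree whose root is a MAX node with children `child 0, …, child n`: these children are
the actions at the root. -/
abbrev maxRoot {n : ℕ} (child : Fin (n + 1) → GameTree) : GameTree :=
  node NodeKind.max n child

end GameTree

open GameTree

/-- A Monte-Carlo tree search model on the tree with root `maxRoot child`: the vector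
`μ = (μ_ℓ)` in `[0,1]^L` of the means of the Bernoulli oracles at the leaves. -/
abbrev MCTSModel {n : ℕ} (child : Fin (n + 1) → GameTree) : Type :=
  (maxRoot child).Leaf → unitInterval

namespace MCTSModel

variable {n : ℕ} {child : Fin (n + 1) → GameTree}

/-- The value `V(s₀)` of the root. -/
noncomputable def rootValue (μ : MCTSModel child) : ℝ :=
  (maxRoot child).value fun l => (μ l : ℝ)

/-- The value `V(s)` of the depth-one node `s`. -/
noncomputable def actionValue (μ : MCTSModel child) (s : Fin (n + 1)) : ℝ :=
  (child s).value fun l => (μ ⟨s, l⟩ : ℝ)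

/-- `s` is a best action at the root, that is, `s ∈ argmax V`. -/
def IsBestAction (μ : MCTSModel child) (s : Fin (n + 1)) : Prop :=
  ∀ s', μ.actionValue s' ≤ μ.actionValue s

/-- The leaf values determine the best action `s*(μ)`. -/
def HasUniqueBestAction (μ : MCTSModel child) : Prop :=
  ∃! s, μ.IsBestAction s

/-- The alternative to `μ`: the `ν ∈ [0,1]^L` under which the best action at the root under `μ` is
not a best action. -/
def Alt (μ : MCTSModel child) : Set (MCTSModel child) :=
  {ν | ∀ s, μ.IsBestAction s → ¬ ν.IsBestAction s}

end MCTSModel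

/-- The binary Kullback-Leibler divergence
`d(x, y) = x ln (x / y) + (1 - x) ln ((1 - x) / (1 - y))` for `x, y ∈ [0,1]`, with values in
`[0, ∞]`, where `0 ln (0 / y) = 0` for all `y` and `x ln (x / 0) = ∞` for `x > 0`. -/
noncomputable def binaryKL (x y : ℝ) : ℝ≥0∞ :=
  open Classical in
  if (y = 0 ∧ x ≠ 0) ∨ (y = 1 ∧ x ≠ 1) then ∞
  else ENNReal.ofReal (x * Real.log (x / y) + (1 - x) * Real.log ((1 - x) / (1 - y)))

namespace MCTSModel

variable {n : ℕ} {child : Fin (n + 1) → GameTree}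

/-- `T*(μ)⁻¹`, the supremum over `w` in the simplex of the infimum over `ν ∈ Alt(μ)` of
`∑_ℓ w_ℓ d(μ_ℓ, ν_ℓ)` (in `[0, ∞]`, with `0 · ∞ = 0` and `inf ∅ = ∞`). -/
noncomputable def invCharTime (μ : MCTSModel child) : ℝ≥0∞ :=
  ⨆ w ∈ stdSimplex ℝ (maxRoot child).Leaf, ⨅ ν ∈ μ.Alt,
    ∑ l, ENNReal.ofReal (w l) * binaryKL (μ l) (ν l)

/-- `T*(μ)`. -/
noncomputable def charTime (μ : MCTSModel child) : ℝ≥0∞ :=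
  μ.invCharTime⁻¹

end MCTSModel

/-- A sequential algorithm that samples elements of `L`, with binary outcomes, and recommends an
element of `A`. It may randomize through a seed in `S`, drawn once at the start. The sampling,
stopping and recommendation rules depend on the seed and on the history, that is, on the list of
the pairs (sampled leaf, outcome) so far, the most recent one first. -/
structure SearchAlgorithm (L A S : Type*) [MeasurableSpace S] where
  /-- The law of the seed. -/
  seedLaw : Measure S
  isProbabilityMeasure_seedLaw : IsProbabilityMeasure seedLaw
  /-- Sampling rule: the leaf to sample next. -/
  sample : S → List (L × Bool) → L
  /-- Stopping rule: whether to stop now. -/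
  stops : S → List (L × Bool) → Prop
  /-- Recommendation rule: the guess, if the algorithm stops now. -/
  recommend : S → List (L × Bool) → A
  measurableSet_sample : ∀ h l, MeasurableSet {u | sample u h = l}
  measurableSet_stops : ∀ h, MeasurableSet {u | stops u h}
  measurableSet_recommend : ∀ h a, MeasurableSet {u | recommend u h = a}

namespace SearchAlgorithm

variable {L A S : Type*} [MeasurableSpace S]

/-- The history `(L_t, X_t), …, (L_1, X_1)` after `t` rounds. In the sample point `ω`, the first
component is the seed, and `ω.2 t l` is the outcome of the oracle `l` if it is called in round
`t + 1`. -/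
def history (alg : SearchAlgorithm L A S) (ω : S × (ℕ → L → Bool)) : ℕ → List (L × Bool)
  | 0 => []
  | t + 1 =>
    (alg.sample ω.1 (alg.history ω t), ω.2 t (alg.sample ω.1 (alg.history ω t))) ::
      alg.history ω t

/-- The number `τ` of samples taken: the first time at which the stopping rule says to stop (`∞` if
it never does). -/
noncomputable def stoppingTime (alg : SearchAlgorithm L A S) (ω : S × (ℕ → L → Bool)) : ℕ∞ :=
  ⨅ (t : ℕ) (_ : alg.stops ω.1 (alg.history ω t)), (t : ℕ∞)

/-- The law when the oracle `l` is Bernoulli with mean `μ l`: all outcomes are independent of each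
other and of the seed. -/
noncomputable def law [Fintype L] (alg : SearchAlgorithm L A S) (μ : L → unitInterval) :
    Measure (S × (ℕ → L → Bool)) :=
  alg.seedLaw.prod
    (Measure.infinitePi fun _ : ℕ => Measure.pi fun l : L => bernoulliMeasure true false (μ l))

/-- The expectation `E_μ[τ]` of the number of samples, in `[0, ∞]`. -/
noncomputable def expectedSamples [Fintype L] (alg : SearchAlgorithm L A S)
    (μ : L → unitInterval) : ℝ≥0∞ :=
  ∫⁻ ω, (alg.stoppingTime ω : ℝ≥0∞) ∂(alg.law μ)

/-- `δ`-correctness with accuracy `ε`: under every model with a unique best action at the root, with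
probability at least `1 - δ` the algorithm stops and recommends an action `s` with
`V(s₀) - V(s) ≤ ε`. -/
def IsCorrect {n : ℕ} {child : Fin (n + 1) → GameTree}
    (alg : SearchAlgorithm (maxRoot child).Leaf (Fin (n + 1)) S) (ε δ : ℝ) : Prop :=
  ∀ ν : MCTSModel child, ν.HasUniqueBestAction →
    ENNReal.ofReal (1 - δ) ≤ alg.law ν {ω | ∃ t : ℕ, alg.stoppingTime ω = t ∧
      ν.rootValue - ν.actionValue (alg.recommend ω.1 (alg.history ω t)) ≤ ε}

end SearchAlgorithm

/-! The bound is a change of measure argument carried out without likelihood ratios. Let `E` be the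
event that the algorithm stops within `T` rounds and recommends `a = s*(μ)`, and put `g = c` on `E`,
`g = -c` off `E`, with `c = log ((1 - δ) / δ)`. The Gibbs variational inequality bounds the `μ`-mean
of `g` minus the information cost, the sum of `d(μ_ℓ, ν_ℓ)` over the sampled leaves, by the
logarithm of the `ν`-mean of `exp g`. It is proved for one Bernoulli sample
(`mul_add_mul_sub_kl_le_log`) and propagated by backward induction
(`step_iterate_sub_totalCost_le`).

If `a` is not best under `ν` and `ν` has a unique best action, then `P_ν(E) ≤ δ`, and `c` is
calibrated so that the `ν`-mean of `exp g` is at most `1`. Hence `2 c P_μ(E) - c` is at most `∑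
E[N_ℓ] d(μ_ℓ, ν_ℓ)`, where `N_ℓ` counts the samples of `ℓ` in the first `T` rounds. An alternative
with ties or boundary means is first perturbed (`exists_interior_strictly_best`), at an information
cost per sample that tends to `0`.

The normalised counts are weights in the simplex, so the sum for the worst `ν` is at most `E_μ[τ] /
T*(μ)` (`le_mul_invCharTime`). As `T → ∞`, `P_μ(E)` has a limit of at least `1 - δ`, and `2 c (1 -
δ) - c = d(δ, 1 - δ)`. -/

namespace SearchAlgorithm

/-! ### Stopped histories and their transition operator -/

variable {L A S : Type*} [MeasurableSpace S]

/-- The history at time `min t τ`. -/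
noncomputable def stoppedHistory (alg : SearchAlgorithm L A S) (ω : S × (ℕ → L → Bool)) :
    ℕ → List (L × Bool)
  | 0 => []
  | t + 1 =>
    open Classical in
    if alg.stops ω.1 (alg.stoppedHistory ω t) then alg.stoppedHistory ω t
    else (alg.sample ω.1 (alg.stoppedHistory ω t),
      ω.2 t (alg.sample ω.1 (alg.stoppedHistory ω t))) :: alg.stoppedHistory ω t

/-- The transition operator of the stopped history, given the seed `u`, when the oracle `l` has
mean `p l`. -/
noncomputable def step (alg : SearchAlgorithm L A S) (u : S) (p : L → ℝ)
    (f : List (L × Bool) → ℝ) (h : List (L × Bool)) : ℝ :=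
  open Classical in
  if alg.stops u h then f h
  else p (alg.sample u h) * f ((alg.sample u h, true) :: h) +
    (1 - p (alg.sample u h)) * f ((alg.sample u h, false) :: h)

lemma step_nonneg (alg : SearchAlgorithm L A S) (μ : L → unitInterval) (u : S)
    {F : List (L × Bool) → ℝ} (hF : ∀ h, 0 ≤ F h)
    (h : List (L × Bool)) : 0 ≤ alg.step u (fun l => μ l) F h := by
  unfold step
  split_ifs
  · exact hF h
  · exact add_nonneg (mul_nonneg (μ _).2.1 (hF _)) (mul_nonneg (sub_nonneg.2 (μ _).2.2) (hF _))

/-! ### Stopped history versus stopping time, path by path -/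

section Pathwise

variable (alg : SearchAlgorithm L A S) (ω : S × (ℕ → L → Bool))

lemma stoppedHistory_succ_of_stops {t : ℕ} (h : alg.stops ω.1 (alg.stoppedHistory ω t)) :
    alg.stoppedHistory ω (t + 1) = alg.stoppedHistory ω t := by
  rw [stoppedHistory, if_pos h]

lemma stoppedHistory_of_le {t T : ℕ} (htT : t ≤ T)
    (h : alg.stops ω.1 (alg.stoppedHistory ω t)) :
    alg.stoppedHistory ω T = alg.stoppedHistory ω t := by
  induction T, htT using Nat.le_induction with
  | base => rfl
  | succ T _ ih => rw [stoppedHistory_succ_of_stops _ _ (by rwa [ih]), ih]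

lemma stoppedHistory_eq_history {t : ℕ} (h : ∀ s < t, ¬ alg.stops ω.1 (alg.history ω s)) :
    alg.stoppedHistory ω t = alg.history ω t := by
  induction t with
  | zero => rfl
  | succ t ih =>
    have := ih fun s hs => h s (hs.trans t.lt_succ_self)
    rw [stoppedHistory, this, if_neg (h t t.lt_succ_self), history]

lemma stoppingTime_eq_coe_iff {t : ℕ} :
    alg.stoppingTime ω = t ↔
      alg.stops ω.1 (alg.history ω t) ∧ ∀ s < t, ¬ alg.stops ω.1 (alg.history ω s) := by
  classical
  constructor
  · intro h
    have hex : ∃ s, alg.stops ω.1 (alg.history ω s) := by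
      by_contra! hne
      simp [stoppingTime, hne] at h
    have hmin : ∀ s < t, ¬ alg.stops ω.1 (alg.history ω s) := by
      intro s hs hst
      have : alg.stoppingTime ω ≤ s := iInf₂_le s hst
      rw [h] at this
      exact absurd (Nat.cast_le.1 this) (not_le.2 hs)
    refine ⟨?_, hmin⟩
    by_contra hnot
    have : ((t + 1 : ℕ) : ℕ∞) ≤ alg.stoppingTime ω := by
      refine le_iInf₂ fun s hs => Nat.cast_le.2 ?_
      by_contra hlt
      rcases Nat.lt_succ_iff_lt_or_eq.1 (not_le.1 hlt) with h' | h'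
      · exact hmin s h' hs
      · exact hnot (h' ▸ hs)
    rw [h] at this
    exact absurd (Nat.cast_le.1 this) (by omega)
  · rintro ⟨h, hmin⟩
    refine le_antisymm (iInf₂_le t h) (le_iInf₂ fun s hs => Nat.cast_le.2 ?_)
    exact not_lt.1 fun hlt => hmin s hlt hs

lemma exists_stoppingTime_eq {T : ℕ} (h : alg.stops ω.1 (alg.stoppedHistory ω T)) :
    ∃ t ≤ T, alg.stoppingTime ω = t ∧ alg.stoppedHistory ω T = alg.history ω t := by
  classical
  by_cases hex : ∃ s, s ≤ T ∧ alg.stops ω.1 (alg.history ω s)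
  · have hs := Nat.find_spec hex
    have hmin : ∀ s < Nat.find hex, ¬ alg.stops ω.1 (alg.history ω s) := fun s hs' hst =>
      Nat.find_min hex hs' ⟨hs'.le.trans hs.1, hst⟩
    have heq := alg.stoppedHistory_eq_history ω hmin
    exact ⟨Nat.find hex, hs.1, (alg.stoppingTime_eq_coe_iff ω).2 ⟨hs.2, hmin⟩, by
      rw [alg.stoppedHistory_of_le ω hs.1 (heq ▸ hs.2), heq]⟩
  · push Not at hex
    rw [alg.stoppedHistory_eq_history ω fun s hs => hex s hs.le] at h
    exact absurd h (hex T le_rfl)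

lemma stoppedHistory_of_stoppingTime_eq {t T : ℕ} (h : alg.stoppingTime ω = t) (htT : t ≤ T) :
    alg.stops ω.1 (alg.stoppedHistory ω T) ∧ alg.stoppedHistory ω T = alg.history ω t := by
  obtain ⟨hs, hmin⟩ := (alg.stoppingTime_eq_coe_iff ω).1 h
  have heq := alg.stoppedHistory_eq_history ω hmin
  rw [alg.stoppedHistory_of_le ω htT (heq ▸ hs), heq]
  exact ⟨hs, rfl⟩

lemma length_stoppedHistory_le (T : ℕ) : (alg.stoppedHistory ω T).length ≤ T := by
  induction T with
  | zero => simp [stoppedHistory]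
  | succ T ih =>
    rw [stoppedHistory]
    split_ifs
    · omega
    · simpa using ih

lemma length_stoppedHistory_le_stoppingTime (T : ℕ) :
    ((alg.stoppedHistory ω T).length : ℕ∞) ≤ alg.stoppingTime ω := by
  classical
  by_cases hτ : ∃ t : ℕ, alg.stoppingTime ω = t
  · obtain ⟨t, ht⟩ := hτ
    have hs := alg.stoppedHistory_of_stoppingTime_eq ω ht le_rfl
    rw [ht, Nat.cast_le]
    rcases le_total t T with htT | hTt
    · rw [alg.stoppedHistory_of_le ω htT hs.1]
      exact alg.length_stoppedHistory_le ω t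
    · exact (alg.length_stoppedHistory_le ω T).trans hTt
  · have : alg.stoppingTime ω = ⊤ := by
      by_contra hne
      obtain ⟨t, ht⟩ := ENat.ne_top_iff_exists.1 hne
      exact hτ ⟨t, ht.symm⟩
    rw [this]
    exact le_top

lemma stoppedHistory_congr (u : S) {ω ω' : ℕ → L → Bool} (T : ℕ) (h : ∀ t < T, ω t = ω' t) :
    alg.stoppedHistory (u, ω) T = alg.stoppedHistory (u, ω') T := by
  induction T with
  | zero => rfl
  | succ T ih =>
    have := ih fun t ht => h t (ht.trans T.lt_succ_self)
    rw [stoppedHistory, stoppedHistory, this]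
    split_ifs
    · rfl
    · simp [h T T.lt_succ_self]

end Pathwise

/-! ### Measurability of the stopped history -/

section Measurability

/-- Histories carry the discrete `σ`-algebra. -/
instance instMeasurableSpaceHistory : MeasurableSpace (List (L × Bool)) := ⊤

instance instDiscreteMeasurableSpaceHistory : DiscreteMeasurableSpace (List (L × Bool)) :=
  ⟨fun _ => trivial⟩

variable [Finite L] (alg : SearchAlgorithm L A S)

/-- With `L` finite there are countably many histories, so joint measurability reduces to each fixed
history. -/
lemma measurable_of_history {Ω β : Type*} [MeasurableSpace Ω] [MeasurableSpace β]
    {X : Ω → List (L × Bool)} (hX : Measurable X) {G : List (L × Bool) → Ω → β}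
    (hG : ∀ h, Measurable (G h)) : Measurable fun ω => G (X ω) ω :=
  (measurable_from_prod_countable_right (f := fun p : List (L × Bool) × Ω => G p.1 p.2) hG).comp
    (hX.prodMk measurable_id)

lemma measurable_stoppedHistory (T : ℕ) :
    Measurable fun ω : S × (ℕ → L → Bool) => alg.stoppedHistory ω T := by
  classical
  induction T with
  | zero => exact measurable_const
  | succ T ih =>
    simp only [stoppedHistory]
    refine measurable_of_history ih (G := fun h ω => if alg.stops ω.1 h then h
      else (alg.sample ω.1 h, ω.2 T (alg.sample ω.1 h)) :: h) fun h => ?_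
    refine Measurable.ite (measurable_fst (alg.measurableSet_stops h)) measurable_const ?_
    let _ : MeasurableSpace L := ⊤
    have hs : Measurable fun ω : S × (ℕ → L → Bool) => alg.sample ω.1 h :=
      measurable_to_countable' fun l => measurable_fst (alg.measurableSet_sample h l)
    have h1 : Measurable fun p : L × (S × (ℕ → L → Bool)) => (p.1, p.2.2 T p.1) :: h :=
      measurable_from_prod_countable_right fun l => by
        have : Measurable fun ω : S × (ℕ → L → Bool) => ω.2 T l := by fun_prop
        exact (measurable_from_top (f := fun b : Bool => (l, b) :: h)).comp
          (by convert this using 1)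
    exact h1.comp (hs.prodMk measurable_id)

lemma measurableSet_stops_recommend (T : ℕ) (a : A) :
    MeasurableSet {ω : S × (ℕ → L → Bool) | alg.stops ω.1 (alg.stoppedHistory ω T) ∧
      alg.recommend ω.1 (alg.stoppedHistory ω T) = a} := by
  refine measurableSet_setOfPred.2 <| measurable_of_history (alg.measurable_stoppedHistory T)
    (G := fun h ω => alg.stops ω.1 h ∧ alg.recommend ω.1 h = a) fun h => ?_
  exact measurableSet_setOfPred.1 <| measurable_fst
    ((alg.measurableSet_stops h).inter (alg.measurableSet_recommend h a))

end Measurability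

/-! ### The stopped history as a Markov chain, for a fixed seed -/

section Law

variable [Fintype L] (alg : SearchAlgorithm L A S) (μ : L → unitInterval)

/-- The law of the outcomes of all oracles in all rounds. -/
noncomputable def outcomeLaw (μ : L → unitInterval) : Measure (ℕ → L → Bool) :=
  Measure.infinitePi fun _ : ℕ => Measure.pi fun l : L => bernoulliMeasure true false (μ l)

instance : IsProbabilityMeasure (outcomeLaw μ) := by
  unfold outcomeLaw; infer_instance

instance : IsProbabilityMeasure (alg.law μ) := by
  have := alg.isProbabilityMeasure_seedLaw
  unfold law; infer_instance

lemma lintegral_pi_bernoulli (l : L) (G : Bool → ℝ≥0∞) :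
    ∫⁻ y, G (y l) ∂(Measure.pi fun l : L => bernoulliMeasure true false (μ l)) =
      ENNReal.ofReal (μ l) * G true + ENNReal.ofReal (1 - μ l) * G false := by
  rw [(measurePreserving_eval (fun l : L => bernoulliMeasure true false (μ l)) l).lintegral_comp
    (f := G) (measurable_of_finite G), bernoulliMeasure_def, lintegral_add_measure]
  simp only [lintegral_smul_measure, lintegral_dirac]
  rw [ENNReal.ofReal_eq_coe_nnreal (μ l).2.1,
    ENNReal.ofReal_eq_coe_nnreal (sub_nonneg.2 (μ l).2.2)]
  rfl

lemma indepFun_stoppedHistory (u : S) (t : ℕ) :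
    IndepFun (fun ω => alg.stoppedHistory (u, ω) t) (fun ω => ω t) (outcomeLaw μ) := by
  have hind : iIndepFun (fun (i : ℕ) (ω : ℕ → L → Bool) => ω i) (outcomeLaw μ) :=
    iIndepFun_infinitePi (X := fun _ y => y) fun _ => measurable_id
  have h := hind.indepFun_finset (Finset.range t) {t} (by simp) fun i => measurable_pi_apply i
  -- The first `t` rounds determine the history; later outcomes are filled in arbitrarily.
  let φ : ((Finset.range t) → L → Bool) → List (L × Bool) := fun y =>
    alg.stoppedHistory (u, fun i => if hi : i ∈ Finset.range t then y ⟨i, hi⟩ else fun _ => true) t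
  let ψ : (({t} : Finset ℕ) → L → Bool) → L → Bool := fun y => y ⟨t, by simp⟩
  have h' := h.comp (φ := φ) (ψ := ψ) (measurable_of_countable φ) (measurable_of_countable ψ)
  convert h' using 1
  swap
  · rfl
  funext ω
  refine alg.stoppedHistory_congr u t fun i hi => ?_
  simp [hi]

/-- The Markov property: round `t` is independent of the history before it, so Fubini integrates out
the newest outcome and leaves one application of `step`. -/
lemma lintegral_stoppedHistory_succ (u : S) (t : ℕ) {F : List (L × Bool) → ℝ}
    (hF : ∀ h, 0 ≤ F h) :
    ∫⁻ ω, ENNReal.ofReal (F (alg.stoppedHistory (u, ω) (t + 1))) ∂(outcomeLaw μ) =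
      ∫⁻ ω, ENNReal.ofReal (alg.step u (fun l => μ l) F (alg.stoppedHistory (u, ω) t))
        ∂(outcomeLaw μ) := by
  classical
  have hX : Measurable fun ω : ℕ → L → Bool => alg.stoppedHistory (u, ω) t :=
    (alg.measurable_stoppedHistory t).comp measurable_prodMk_left
  have hY : Measurable fun ω : ℕ → L → Bool => ω t := measurable_pi_apply t
  let G : List (L × Bool) × (L → Bool) → ℝ≥0∞ := fun p =>
    ENNReal.ofReal (F (if alg.stops u p.1 then p.1
      else (alg.sample u p.1, p.2 (alg.sample u p.1)) :: p.1))
  have hG : Measurable G := measurable_of_countable G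
  have hmap := (indepFun_iff_map_prod_eq_prod_map_map hX.aemeasurable hY.aemeasurable).1
    (alg.indepFun_stoppedHistory μ u t)
  have hYmap : (outcomeLaw μ).map (fun ω => ω t) =
      Measure.pi fun l : L => bernoulliMeasure true false (μ l) :=
    (measurePreserving_eval_infinitePi _ t).map_eq
  calc ∫⁻ ω, ENNReal.ofReal (F (alg.stoppedHistory (u, ω) (t + 1))) ∂(outcomeLaw μ)
      = ∫⁻ ω, G (alg.stoppedHistory (u, ω) t, ω t) ∂(outcomeLaw μ) := rfl
    _ = ∫⁻ p, G p ∂((outcomeLaw μ).map fun ω => (alg.stoppedHistory (u, ω) t, ω t)) :=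
      (lintegral_map hG (hX.prodMk hY)).symm
    _ = ∫⁻ h, ∫⁻ y, G (h, y) ∂(Measure.pi fun l : L => bernoulliMeasure true false (μ l))
          ∂((outcomeLaw μ).map fun ω => alg.stoppedHistory (u, ω) t) := by
      rw [hmap, hYmap, lintegral_prod _ hG.aemeasurable]
    _ = ∫⁻ h, ENNReal.ofReal (alg.step u (fun l => μ l) F h)
          ∂((outcomeLaw μ).map fun ω => alg.stoppedHistory (u, ω) t) := by
      refine lintegral_congr fun h => ?_
      by_cases hs : alg.stops u h
      · simp [G, step, hs]
      · simp only [G, step, hs, if_false]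
        rw [lintegral_pi_bernoulli μ (alg.sample u h)
          (fun b => ENNReal.ofReal (F ((alg.sample u h, b) :: h))),
          ENNReal.ofReal_add (mul_nonneg (μ _).2.1 (hF _))
            (mul_nonneg (sub_nonneg.2 (μ _).2.2) (hF _)),
          ENNReal.ofReal_mul (μ _).2.1, ENNReal.ofReal_mul (sub_nonneg.2 (μ _).2.2)]
    _ = _ := lintegral_map (measurable_of_countable _) hX

lemma lintegral_stoppedHistory (u : S) (T : ℕ) {F : List (L × Bool) → ℝ} (hF : ∀ h, 0 ≤ F h) :
    ∫⁻ ω, ENNReal.ofReal (F (alg.stoppedHistory (u, ω) T)) ∂(outcomeLaw μ) =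
      ENNReal.ofReal (((alg.step u fun l => μ l)^[T] F) []) := by
  induction T generalizing F with
  | zero => simp [stoppedHistory]
  | succ T ih =>
    rw [lintegral_stoppedHistory_succ _ _ _ _ hF, ih fun h => alg.step_nonneg μ u hF h,
      Function.iterate_succ_apply]

lemma lintegral_law {f : S × (ℕ → L → Bool) → ℝ≥0∞} (hf : Measurable f) :
    ∫⁻ ω, f ω ∂(alg.law μ) = ∫⁻ u, ∫⁻ ω, f (u, ω) ∂(outcomeLaw μ) ∂alg.seedLaw :=
  lintegral_prod _ hf.aemeasurable

end Law

end SearchAlgorithm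

/-! ### Inequalities for the binary divergence -/

section BinaryKL

/-- Gibbs variational inequality on two points. With `z` the mean of the exponentials under `q`,
apply `log t ≤ t - 1` to the ratio of the tilted weight `q * exp x / z` to `m`, and likewise to the
other outcome. Both pairs of weights sum to `1`, so the right-hand sides cancel. -/
lemma mul_add_mul_sub_kl_le_log {m q : ℝ} (hm0 : 0 ≤ m) (hm1 : m ≤ 1) (hq0 : 0 < q) (hq1 : q < 1)
    (x y : ℝ) :
    m * x + (1 - m) * y - (m * Real.log (m / q) + (1 - m) * Real.log ((1 - m) / (1 - q))) ≤
      Real.log (q * Real.exp x + (1 - q) * Real.exp y) := by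
  have key : ∀ {m q x z : ℝ}, 0 ≤ m → 0 < q → 0 < z →
      m * x - m * Real.log (m / q) - m * Real.log z ≤ q * Real.exp x / z - m := by
    intro m q x z hm hq hz
    rcases hm.eq_or_lt with rfl | hm
    · simpa using by positivity
    · have h := Real.log_le_sub_one_of_pos (show 0 < q * Real.exp x / (m * z) by positivity)
      rw [Real.log_div (by positivity) (by positivity), Real.log_mul (by positivity) (by positivity),
        Real.log_mul (by positivity) (by positivity), Real.log_exp] at h
      rw [Real.log_div (by positivity) (by positivity)]
      have h' := mul_le_mul_of_nonneg_left h hm.le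
      have e : m * (q * Real.exp x / (m * z) - 1) = q * Real.exp x / z - m := by
        field_simp
      rw [e] at h'
      linarith
  have hq1' : 0 < 1 - q := sub_pos.2 hq1
  have hz : 0 < q * Real.exp x + (1 - q) * Real.exp y := by positivity
  have h1 := key (x := x) hm0 hq0 hz
  have h2 := key (x := y) (sub_nonneg.2 hm1) hq1' hz
  have h3 : q * Real.exp x / (q * Real.exp x + (1 - q) * Real.exp y) +
      (1 - q) * Real.exp y / (q * Real.exp x + (1 - q) * Real.exp y) = 1 := by
    rw [← add_div, div_self hz.ne']
  linarith

lemma kl_nonneg {m q : ℝ} (hm0 : 0 ≤ m) (hm1 : m ≤ 1) (hq0 : 0 < q) (hq1 : q < 1) :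
    0 ≤ m * Real.log (m / q) + (1 - m) * Real.log ((1 - m) / (1 - q)) := by
  have := mul_add_mul_sub_kl_le_log hm0 hm1 hq0 hq1 0 0
  simp at this
  linarith

lemma binaryKL_of_mem_Ioo {q : ℝ} (m : ℝ) (hq0 : 0 < q) (hq1 : q < 1) :
    binaryKL m q =
      ENNReal.ofReal (m * Real.log (m / q) + (1 - m) * Real.log ((1 - m) / (1 - q))) := by
  rw [binaryKL, if_neg]
  rintro (h | h)
  · exact hq0.ne' h.1
  · exact hq1.ne h.1

/-- Both outcome probabilities lose at most a factor `1 - ε`, so each log-ratio grows by at most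
`-log (1 - ε)`. This controls the price of moving `q`, possibly `0` or `1`, into the interior. -/
lemma binaryKL_le_add_neg_log {m q q' ε : ℝ} (hm0 : 0 ≤ m) (hm1 : m ≤ 1) (hq0 : 0 ≤ q)
    (hq1 : q ≤ 1) (hq'0 : 0 < q') (hq'1 : q' < 1) (hε : ε < 1) (h : (1 - ε) * q ≤ q')
    (h' : (1 - ε) * (1 - q) ≤ 1 - q') :
    binaryKL m q' ≤ binaryKL m q + ENNReal.ofReal (-Real.log (1 - ε)) := by
  by_cases hinf : (q = 0 ∧ m ≠ 0) ∨ (q = 1 ∧ m ≠ 1)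
  · rw [binaryKL.eq_def m q, if_pos hinf, top_add]
    exact le_top
  have key : ∀ {m q q' : ℝ}, 0 ≤ m → 0 ≤ q → 0 < q' → (1 - ε) * q ≤ q' → (q = 0 → m = 0) →
      m * Real.log (m / q') ≤ m * Real.log (m / q) + m * (-Real.log (1 - ε)) := by
    intro m q q' hm hq hq' hle h0
    rcases hm.eq_or_lt with rfl | hm
    · simp
    have hq : 0 < q := hq.lt_of_ne fun h => hm.ne' (h0 h.symm)
    have hε' : 0 < 1 - ε := sub_pos.2 hε
    rw [← mul_add]
    refine mul_le_mul_of_nonneg_left ?_ hm.le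
    rw [Real.log_div hm.ne' hq'.ne', Real.log_div hm.ne' hq.ne']
    have := Real.log_le_log (by positivity) hle
    rw [Real.log_mul hε'.ne' hq.ne'] at this
    linarith
  push Not at hinf
  have h1 := key hm0 hq0 hq'0 h hinf.1
  have h2 := key (sub_nonneg.2 hm1) (sub_nonneg.2 hq1) (sub_pos.2 hq'1) h' fun h => by
    rw [hinf.2 (by linarith)]; simp
  rw [binaryKL_of_mem_Ioo m hq'0 hq'1, binaryKL.eq_def m q,
    if_neg (by rintro (h | h) <;> tauto)]
  refine (ENNReal.ofReal_le_ofReal ?_).trans ENNReal.ofReal_add_le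
  linarith

lemma binaryKL_one_sub {δ : ℝ} (hδ0 : 0 < δ) (hδ1 : δ < 1) :
    binaryKL δ (1 - δ) = ENNReal.ofReal ((1 - 2 * δ) * Real.log ((1 - δ) / δ)) := by
  rw [binaryKL_of_mem_Ioo _ (by linarith) (by linarith), sub_sub_cancel, ← inv_div, Real.log_inv]
  congr 1
  ring

end BinaryKL

namespace SearchAlgorithm

variable {L A S : Type*} [MeasurableSpace S] (alg : SearchAlgorithm L A S)

/-! ### Change of measure for a fixed seed -/

section Step

variable (u : S) (p : L → ℝ)

lemma step_iterate_linear (T : ℕ) (α β : ℝ) (f g : List (L × Bool) → ℝ) :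
    (alg.step u p)^[T] (fun h => α * f h + β * g h) =
      fun h => α * (alg.step u p)^[T] f h + β * (alg.step u p)^[T] g h := by
  induction T with
  | zero => rfl
  | succ T ih =>
    simp only [Function.iterate_succ_apply', ih]
    funext h
    simp only [step]
    split_ifs <;> ring

lemma step_iterate_one (T : ℕ) : (alg.step u p)^[T] (fun _ => 1) = fun _ => 1 := by
  induction T with
  | zero => rfl
  | succ T ih =>
    rw [Function.iterate_succ_apply', ih]
    funext h
    simp [step]

lemma step_iterate_pos (hp0 : ∀ l, 0 < p l) (hp1 : ∀ l, p l < 1) (T : ℕ)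
    {f : List (L × Bool) → ℝ} (hf : ∀ h, 0 < f h) (h : List (L × Bool)) :
    0 < (alg.step u p)^[T] f h := by
  induction T generalizing h with
  | zero => exact hf h
  | succ T ih =>
    rw [Function.iterate_succ_apply', step]
    split_ifs
    · exact ih h
    · exact add_pos (mul_pos (hp0 _) (ih _)) (mul_pos (sub_pos.2 (hp1 _)) (ih _))

/-- The total of the costs `D l` of the sampled leaves `l`. -/
def totalCost (D : L → ℝ) (h : List (L × Bool)) : ℝ := (h.map fun x => D x.1).sum

/-- Gibbs variational inequality for the stopped process. In the inductive step, the two-point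
inequality is applied to the logarithms of the continuation values after either outcome; its
divergence term is the cost of the new sample. -/
lemma step_iterate_sub_totalCost_le (m q : L → ℝ) (hm0 : ∀ l, 0 ≤ m l) (hm1 : ∀ l, m l ≤ 1)
    (hq0 : ∀ l, 0 < q l) (hq1 : ∀ l, q l < 1) (g : List (L × Bool) → ℝ) (T : ℕ)
    (h : List (L × Bool)) :
    (alg.step u m)^[T] (fun h => g h - totalCost (fun l => m l * Real.log (m l / q l) +
        (1 - m l) * Real.log ((1 - m l) / (1 - q l))) h) h ≤
      Real.log ((alg.step u q)^[T] (fun h => Real.exp (g h)) h) -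
        totalCost (fun l => m l * Real.log (m l / q l) +
          (1 - m l) * Real.log ((1 - m l) / (1 - q l))) h := by
  induction T generalizing h with
  | zero => simp
  | succ T ih =>
    rw [Function.iterate_succ_apply', Function.iterate_succ_apply']
    by_cases hs : alg.stops u h
    · rw [step, if_pos hs, step, if_pos hs]
      exact ih h
    · rw [step, if_neg hs, step, if_neg hs]
      have h1 := ih ((alg.sample u h, true) :: h)
      have h0 := ih ((alg.sample u h, false) :: h)
      have hpos := alg.step_iterate_pos u q hq0 hq1 T (f := fun h => Real.exp (g h))
        fun h => Real.exp_pos _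
      have hg := mul_add_mul_sub_kl_le_log (hm0 (alg.sample u h)) (hm1 (alg.sample u h))
        (hq0 (alg.sample u h)) (hq1 (alg.sample u h))
        (Real.log ((alg.step u q)^[T] (fun h => Real.exp (g h)) ((alg.sample u h, true) :: h)))
        (Real.log ((alg.step u q)^[T] (fun h => Real.exp (g h)) ((alg.sample u h, false) :: h)))
      rw [Real.exp_log (hpos _), Real.exp_log (hpos _)] at hg
      simp only [totalCost, List.map_cons, List.sum_cons] at h1 h0 ⊢
      have h1' := mul_le_mul_of_nonneg_left h1 (hm0 (alg.sample u h))
      have h0' := mul_le_mul_of_nonneg_left h0 (sub_nonneg.2 (hm1 (alg.sample u h)))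
      refine (add_le_add h1' h0').trans ?_
      linarith

open Classical in
/-- The indicator of the histories after which the algorithm stops and recommends `a`. -/
noncomputable def stopsRecommend (a : A) (h : List (L × Bool)) : ℝ :=
  if alg.stops u h ∧ alg.recommend u h = a then 1 else 0

/-- The preceding bound for `g = ±c`, with the logarithm relaxed by `log z ≤ z - 1`. The result is
affine in the probabilities and the expected cost, and so can be averaged over the seed. -/
lemma step_iterate_change_of_measure (m q : L → ℝ) (hm0 : ∀ l, 0 ≤ m l) (hm1 : ∀ l, m l ≤ 1)
    (hq0 : ∀ l, 0 < q l) (hq1 : ∀ l, q l < 1) (a : A) (c : ℝ) (T : ℕ) :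
    2 * c * (alg.step u m)^[T] (alg.stopsRecommend u a) [] + 1 ≤
      c + (alg.step u m)^[T] (totalCost fun l => m l * Real.log (m l / q l) +
          (1 - m l) * Real.log ((1 - m l) / (1 - q l))) [] +
        (Real.exp c - Real.exp (-c)) * (alg.step u q)^[T] (alg.stopsRecommend u a) [] +
        Real.exp (-c) := by
  set D : L → ℝ := fun l => m l * Real.log (m l / q l) +
    (1 - m l) * Real.log ((1 - m l) / (1 - q l))
  set g : List (L × Bool) → ℝ := fun h => 2 * c * alg.stopsRecommend u a h + (-c) * 1 with hg
  have h := alg.step_iterate_sub_totalCost_le u m q hm0 hm1 hq0 hq1 g T []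
  have hpos := alg.step_iterate_pos u q hq0 hq1 T (f := fun h => Real.exp (g h))
    (fun h => Real.exp_pos _) []
  have hlog := Real.log_le_sub_one_of_pos hpos
  have hexp : (fun h => Real.exp (g h)) = fun h =>
      (Real.exp c - Real.exp (-c)) * alg.stopsRecommend u a h + Real.exp (-c) * 1 := by
    funext h
    simp only [hg, stopsRecommend]
    split_ifs
    · rw [show 2 * c * 1 + -c * 1 = c by ring]; ring
    · simp
  have hsub : (fun h => g h - totalCost D h) = fun h => 1 * g h + (-1) * totalCost D h := by
    funext h; ring
  have h0 : totalCost D [] = 0 := rfl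
  rw [hexp, step_iterate_linear, step_iterate_one] at hlog
  change _ ≤ Real.log ((alg.step u q)^[T] (fun h => Real.exp (g h)) []) - totalCost D [] at h
  change (alg.step u m)^[T] (fun h => g h - totalCost D h) [] ≤ _ at h
  rw [hsub, step_iterate_linear, hg, step_iterate_linear, step_iterate_one, hexp,
    step_iterate_linear, step_iterate_one, h0] at h
  linarith

end Step

/-! ### Averaging over the seed: expected counts and the change of measure -/

section Law

lemma step_iterate_nonneg (μ : L → unitInterval) (u : S) (T : ℕ) {F : List (L × Bool) → ℝ}
    (hF : ∀ h, 0 ≤ F h) (h : List (L × Bool)) : 0 ≤ (alg.step u fun l => μ l)^[T] F h := by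
  induction T generalizing h with
  | zero => exact hF h
  | succ T ih =>
    rw [Function.iterate_succ_apply']
    exact alg.step_nonneg μ u ih h

lemma stopsRecommend_nonneg (u : S) (a : A) (h : List (L × Bool)) :
    0 ≤ alg.stopsRecommend u a h := by
  unfold stopsRecommend
  split_ifs <;> norm_num

lemma totalCost_nonneg {D : L → ℝ} (hD : ∀ l, 0 ≤ D l) (h : List (L × Bool)) :
    0 ≤ totalCost D h :=
  List.sum_nonneg fun x hx => by
    obtain ⟨y, -, rfl⟩ := List.mem_map.1 hx
    exact hD _

variable [Fintype L] (μ : L → unitInterval)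

/-- The event that the algorithm stops within `T` rounds and recommends `a`. -/
def stopsRecommendBy (a : A) (T : ℕ) : Set (S × (ℕ → L → Bool)) :=
  {ω | alg.stops ω.1 (alg.stoppedHistory ω T) ∧ alg.recommend ω.1 (alg.stoppedHistory ω T) = a}

lemma law_stopsRecommendBy (a : A) (T : ℕ) :
    alg.law μ (alg.stopsRecommendBy a T) =
      ∫⁻ u, ENNReal.ofReal ((alg.step u fun l => μ l)^[T] (alg.stopsRecommend u a) [])
        ∂alg.seedLaw := by
  have hE : MeasurableSet (alg.stopsRecommendBy a T) := alg.measurableSet_stops_recommend T a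
  rw [← lintegral_indicator_one hE, lintegral_law _ _ (measurable_one.indicator hE)]
  refine lintegral_congr fun u => ?_
  rw [← alg.lintegral_stoppedHistory μ u T (alg.stopsRecommend_nonneg u a)]
  refine lintegral_congr fun ω => ?_
  by_cases h : alg.stops u (alg.stoppedHistory (u, ω) T) ∧
      alg.recommend u (alg.stoppedHistory (u, ω) T) = a
  · rw [Set.indicator_of_mem (show (u, ω) ∈ alg.stopsRecommendBy a T from h), stopsRecommend,
      if_pos h]
    simp
  · rw [Set.indicator_of_notMem (show (u, ω) ∉ alg.stopsRecommendBy a T from h), stopsRecommend,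
      if_neg h]
    simp

open Classical in
/-- The expected number of samples of the leaf `l` in the first `T` rounds. -/
noncomputable def expectedCount (T : ℕ) (l : L) : ℝ≥0∞ :=
  ∫⁻ ω, ((alg.stoppedHistory ω T).countP fun x => x.1 = l : ℕ) ∂(alg.law μ)

open Classical in
lemma ofReal_totalCost {D : L → ℝ} (hD : ∀ l, 0 ≤ D l) (h : List (L × Bool)) :
    ENNReal.ofReal (totalCost D h) =
      ∑ l, ((h.countP fun x => x.1 = l : ℕ) : ℝ≥0∞) * ENNReal.ofReal (D l) := by
  induction h with
  | nil => simp [totalCost]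
  | cons x h ih =>
    have : totalCost D (x :: h) = D x.1 + totalCost D h := by simp [totalCost]
    rw [this, ENNReal.ofReal_add (hD _) (totalCost_nonneg hD _), ih]
    simp only [List.countP_cons, Nat.cast_add, add_mul, Finset.sum_add_distrib]
    rw [add_comm]
    simp

lemma lintegral_step_totalCost {D : L → ℝ} (hD : ∀ l, 0 ≤ D l) (T : ℕ) :
    ∫⁻ u, ENNReal.ofReal ((alg.step u fun l => μ l)^[T] (totalCost D) []) ∂alg.seedLaw =
      ∑ l, alg.expectedCount μ T l * ENNReal.ofReal (D l) := by
  classical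
  have hmeas (f : List (L × Bool) → ℝ≥0∞) : Measurable fun ω : S × (ℕ → L → Bool) =>
      f (alg.stoppedHistory ω T) :=
    (measurable_of_countable f).comp (alg.measurable_stoppedHistory T)
  calc _ = ∫⁻ ω, ENNReal.ofReal (totalCost D (alg.stoppedHistory ω T)) ∂(alg.law μ) := by
        rw [lintegral_law _ _ (hmeas fun h => ENNReal.ofReal (totalCost D h))]
        exact lintegral_congr fun u =>
          (alg.lintegral_stoppedHistory μ u T (totalCost_nonneg hD)).symm
    _ = _ := by
        simp only [ofReal_totalCost hD]
        rw [lintegral_finsetSum _ fun l _ =>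
          hmeas fun h => ((h.countP fun x => x.1 = l : ℕ) : ℝ≥0∞) * ENNReal.ofReal (D l)]
        refine Finset.sum_congr rfl fun l _ => ?_
        rw [lintegral_mul_const _ (hmeas fun h => ((h.countP fun x => x.1 = l : ℕ) : ℝ≥0∞)),
          expectedCount]

lemma sum_expectedCount (T : ℕ) :
    ∑ l, alg.expectedCount μ T l = ∫⁻ ω, ((alg.stoppedHistory ω T).length : ℝ≥0∞) ∂(alg.law μ) := by
  classical
  have hmeas (f : List (L × Bool) → ℝ≥0∞) : Measurable fun ω : S × (ℕ → L → Bool) =>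
      f (alg.stoppedHistory ω T) :=
    (measurable_of_countable f).comp (alg.measurable_stoppedHistory T)
  simp only [expectedCount]
  rw [← lintegral_finsetSum _ fun l _ =>
    hmeas fun h => ((h.countP fun x => x.1 = l : ℕ) : ℝ≥0∞)]
  refine lintegral_congr fun ω => ?_
  have h := ofReal_totalCost (D := fun _ => (1 : ℝ)) (fun _ => zero_le_one) (alg.stoppedHistory ω T)
  simp only [totalCost, List.map_const', List.sum_replicate, ENNReal.ofReal_one, mul_one,
    nsmul_eq_mul, ENNReal.ofReal_natCast] at h
  exact h.symm

lemma sum_expectedCount_le_expectedSamples (T : ℕ) :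
    ∑ l, alg.expectedCount μ T l ≤ alg.expectedSamples μ := by
  rw [sum_expectedCount]
  refine lintegral_mono fun ω => ?_
  have := ENat.toENNReal_le.2 (alg.length_stoppedHistory_le_stoppingTime ω T)
  simpa using this

lemma sum_expectedCount_ne_top (T : ℕ) : ∑ l, alg.expectedCount μ T l ≠ ∞ := by
  rw [sum_expectedCount]
  refine ne_top_of_le_ne_top (ENNReal.natCast_ne_top T) ?_
  calc _ ≤ ∫⁻ _, (T : ℝ≥0∞) ∂(alg.law μ) := lintegral_mono fun ω =>
        Nat.cast_le.2 (alg.length_stoppedHistory_le ω T)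
    _ = T := by simp

lemma change_of_measure (ν : L → unitInterval) (hν0 : ∀ l, 0 < (ν l : ℝ))
    (hν1 : ∀ l, (ν l : ℝ) < 1) (a : A) {c : ℝ} (hc : 0 ≤ c) (T : ℕ) :
    ENNReal.ofReal (2 * c) * alg.law μ (alg.stopsRecommendBy a T) + 1 ≤
      ENNReal.ofReal c + ∑ l, alg.expectedCount μ T l * binaryKL (μ l) (ν l) +
        ENNReal.ofReal (Real.exp c - Real.exp (-c)) * alg.law ν (alg.stopsRecommendBy a T) +
        ENNReal.ofReal (Real.exp (-c)) := by
  have := alg.isProbabilityMeasure_seedLaw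
  set D : L → ℝ := fun l => μ l * Real.log (μ l / ν l) +
    (1 - μ l) * Real.log ((1 - μ l) / (1 - ν l))
  have hD : ∀ l, 0 ≤ D l := fun l => kl_nonneg (μ l).2.1 (μ l).2.2 (hν0 l) (hν1 l)
  have hkl : ∀ l, binaryKL (μ l) (ν l) = ENNReal.ofReal (D l) := fun l =>
    binaryKL_of_mem_Ioo _ (hν0 l) (hν1 l)
  have hR : 0 ≤ Real.exp c - Real.exp (-c) := sub_nonneg.2 (Real.exp_le_exp.2 (by linarith))
  -- Measurability in the seed is obtained by writing the iterate as a partial integral of a jointly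
  -- measurable function.
  have hmeas : Measurable fun u =>
      ENNReal.ofReal ((alg.step u fun l => μ l)^[T] (totalCost D) []) := by
    simp only [← alg.lintegral_stoppedHistory μ _ T (totalCost_nonneg hD)]
    exact Measurable.lintegral_prod_right' (f := fun ω : S × (ℕ → L → Bool) =>
      ENNReal.ofReal (totalCost D (alg.stoppedHistory ω T)))
      ((measurable_of_countable fun h => ENNReal.ofReal (totalCost D h)).comp
        (alg.measurable_stoppedHistory T))
  simp only [hkl]
  rw [law_stopsRecommendBy, law_stopsRecommendBy, ← lintegral_step_totalCost _ _ hD,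
    ← lintegral_const_mul' _ _ ENNReal.ofReal_ne_top,
    ← lintegral_const_mul' _ _ ENNReal.ofReal_ne_top]
  have hconst (x : ℝ≥0∞) : x = ∫⁻ _, x ∂alg.seedLaw := by simp
  rw [hconst 1, hconst (ENNReal.ofReal c), hconst (ENNReal.ofReal (Real.exp (-c))),
    ← lintegral_add_right _ measurable_const, ← lintegral_add_left measurable_const,
    ← lintegral_add_left (hmeas.const_add (ENNReal.ofReal c)), ← lintegral_add_right _ measurable_const]
  refine lintegral_mono fun u => ?_
  refine le_trans (le_of_eq ?_) ((ENNReal.ofReal_le_ofReal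
    (alg.step_iterate_change_of_measure u (fun l => μ l) (fun l => ν l) (fun l => (μ l).2.1)
      (fun l => (μ l).2.2) hν0 hν1 a c T)).trans ?_)
  · rw [← ENNReal.ofReal_mul (by positivity), ← ENNReal.ofReal_one,
      ← ENNReal.ofReal_add _ zero_le_one]
    refine mul_nonneg (by positivity) (alg.step_iterate_nonneg μ u T
      (alg.stopsRecommend_nonneg u a) [])
  · refine ENNReal.ofReal_add_le.trans (add_le_add_left (ENNReal.ofReal_add_le.trans
      (add_le_add ENNReal.ofReal_add_le ?_)) _)
    rw [ENNReal.ofReal_mul hR]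

end Law

end SearchAlgorithm

/-! ### Perturbed models and the characteristic time -/

/-- Nondecreasing maps commute with maxima and minima. -/
lemma GameTree.value_affine (T : GameTree) {a : ℝ} (ha : 0 ≤ a) (b : ℝ) (μ : T.Leaf → ℝ) :
    (T.value fun l => a * μ l + b) = a * T.value μ + b := by
  have hmono : Monotone fun x : ℝ => a * x + b := fun x y h => by
    simpa using mul_le_mul_of_nonneg_left h ha
  induction T with
  | leaf => rfl
  | node k n child ih =>
    cases k
    · simp only [value, ih]
      exact (Finset.apply_sup'_eq_sup'_comp Finset.univ_nonempty (fun x : ℝ => a * x + b)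
        fun x y => hmono.map_sup x y).symm
    · simp only [value, ih]
      exact (Finset.apply_inf'_eq_inf'_comp Finset.univ_nonempty (fun x : ℝ => a * x + b)
        fun x y => hmono.map_inf x y).symm

namespace MCTSModel

variable {n : ℕ} {child : Fin (n + 1) → GameTree}

lemma actionValue_le_rootValue (μ : MCTSModel child) (s : Fin (n + 1)) :
    μ.actionValue s ≤ μ.rootValue :=
  Finset.le_sup' (f := μ.actionValue) (Finset.mem_univ s)

lemma isBestAction_iff (μ : MCTSModel child) (s : Fin (n + 1)) :
    μ.IsBestAction s ↔ μ.rootValue - μ.actionValue s ≤ 0 := by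
  rw [sub_nonpos]
  refine ⟨fun h => Finset.sup'_le Finset.univ_nonempty _ fun s' _ => h s', fun h s' => ?_⟩
  exact (μ.actionValue_le_rootValue s').trans h

lemma exists_isBestAction (μ : MCTSModel child) : ∃ s, μ.IsBestAction s :=
  Finite.exists_max μ.actionValue

/-- Shrinking the leaf values towards the interior, with a bonus for the leaves below the best
action `s`, makes `s` the unique best action. -/
lemma exists_interior_strictly_best (ν : MCTSModel child) {s : Fin (n + 1)}
    (hs : ν.IsBestAction s) {ε : ℝ} (hε0 : 0 < ε) (hε1 : ε < 1) :
    ∃ ν' : MCTSModel child, (∀ l, 0 < (ν' l : ℝ)) ∧ (∀ l, (ν' l : ℝ) < 1) ∧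
      (∀ l, (1 - ε) * ν l ≤ ν' l) ∧ (∀ l, (1 - ε) * (1 - ν l) ≤ 1 - ν' l) ∧
      ∀ s', s' ≠ s → ν'.actionValue s' < ν'.actionValue s := by
  classical
  have hε : 0 < 1 - ε := sub_pos.2 hε1
  -- Any two bonuses strictly between `0` and `ε` keep the means in the interior; the larger one at
  -- `s` breaks ties. Constancy on each subtree lets `value_affine` apply.
  let b : Fin (n + 1) → ℝ := fun j => if j = s then ε * (2 / 3) else ε * (1 / 3)
  have hb0 : ∀ j, 0 < b j := fun j => by simp only [b]; split_ifs <;> positivity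
  have hb1 : ∀ j, b j < ε := fun j => by simp only [b]; split_ifs <;> linarith
  have h0 : ∀ l : (maxRoot child).Leaf, 0 < (1 - ε) * (ν l : ℝ) + b l.1 := fun l => by
    have := mul_nonneg hε.le (ν l).2.1
    linarith [hb0 l.1]
  have h1 : ∀ l : (maxRoot child).Leaf, (1 - ε) * (ν l : ℝ) + b l.1 < 1 := fun l => by
    have := mul_le_mul_of_nonneg_left (ν l).2.2 hε.le
    linarith [hb1 l.1]
  let ν' : MCTSModel child := fun l => ⟨(1 - ε) * ν l + b l.1, (h0 l).le, (h1 l).le⟩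
  have hval : ∀ j, ν'.actionValue j = (1 - ε) * ν.actionValue j + b j := fun j =>
    (child j).value_affine hε.le (b j) fun l => (ν ⟨j, l⟩ : ℝ)
  refine ⟨ν', h0, h1, fun l => ?_, fun l => ?_, fun s' hs' => ?_⟩
  · change _ ≤ (1 - ε) * (ν l : ℝ) + b l.1
    linarith [hb0 l.1]
  · change _ ≤ 1 - ((1 - ε) * (ν l : ℝ) + b l.1)
    linarith [hb1 l.1]
  · rw [hval, hval]
    have := mul_le_mul_of_nonneg_left (hs s') hε.le
    simp only [b, if_neg hs', if_true]
    linarith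

/-- The characteristic time bounds any sampling effort that separates `μ` from its alternative. -/
lemma le_mul_invCharTime {μ : MCTSModel child} (hAlt : μ.Alt.Nonempty)
    {N : (maxRoot child).Leaf → ℝ≥0∞} (hN : ∑ l, N l ≠ ∞) {x : ℝ≥0∞}
    (hx : ∀ ν ∈ μ.Alt, x ≤ ∑ l, N l * binaryKL (μ l) (ν l)) :
    x ≤ (∑ l, N l) * μ.invCharTime := by
  rcases eq_or_ne (∑ l, N l) 0 with h0 | h0
  · obtain ⟨ν, hν⟩ := hAlt
    have hz : ∀ l, N l = 0 := by simpa using h0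
    simpa [hz] using hx ν hν
  have hNl : ∀ l, N l / ∑ l, N l ≠ ∞ := fun l =>
    ENNReal.div_ne_top (ENNReal.sum_ne_top.1 hN l (Finset.mem_univ l)) h0
  -- The sampling proportions serve as the weights in the supremum.
  have hw : (fun l => (N l / ∑ l, N l).toReal) ∈ stdSimplex ℝ (maxRoot child).Leaf := by
    refine ⟨fun l => ENNReal.toReal_nonneg, ?_⟩
    rw [← ENNReal.toReal_sum fun l _ => hNl l]
    simp only [div_eq_mul_inv]
    rw [← Finset.sum_mul, ENNReal.mul_inv_cancel h0 hN, ENNReal.toReal_one]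
  rw [mul_comm]
  refine (ENNReal.div_le_iff h0 hN).1 ?_
  refine le_trans (le_iInf₂ fun ν hν => ?_) (le_iSup₂ (f := fun w
    (_ : w ∈ stdSimplex ℝ (maxRoot child).Leaf) => ⨅ ν ∈ μ.Alt,
      ∑ l, ENNReal.ofReal (w l) * binaryKL (μ l) (ν l)) _ hw)
  refine (ENNReal.div_le_iff h0 hN).2 ((hx ν hν).trans (le_of_eq ?_))
  rw [Finset.sum_mul]
  refine Finset.sum_congr rfl fun l _ => ?_
  rw [ENNReal.ofReal_toReal (hNl l), mul_right_comm, ENNReal.div_mul_cancel h0 hN]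

/-- Any vertex of the simplex gives an infimum over the empty set, which is `∞`. -/
lemma charTime_eq_zero_of_alt_eq_empty {μ : MCTSModel child}
    [Nonempty (maxRoot child).Leaf] (h : μ.Alt = ∅) : μ.charTime = 0 := by
  classical
  obtain ⟨l⟩ := ‹Nonempty (maxRoot child).Leaf›
  rw [charTime, ENNReal.inv_eq_zero, eq_top_iff, invCharTime]
  refine le_trans ?_ (le_iSup₂ (f := fun w
    (_ : w ∈ stdSimplex ℝ (maxRoot child).Leaf) => ⨅ ν ∈ μ.Alt,
      ∑ l, ENNReal.ofReal (w l) * binaryKL (μ l) (ν l)) _ (single_mem_stdSimplex ℝ l))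
  simp [h]

end MCTSModel

/-! ### Consequences of correctness and the lower bound -/

namespace SearchAlgorithm

variable {n : ℕ} {child : Fin (n + 1) → GameTree} {S : Type*} [MeasurableSpace S]
  {alg : SearchAlgorithm (maxRoot child).Leaf (Fin (n + 1)) S} {δ : ℝ}

lemma IsCorrect.law_stopsRecommendBy_le (halg : alg.IsCorrect 0 δ) (hδ0 : 0 ≤ δ) (hδ1 : δ ≤ 1)
    {ν : MCTSModel child} (hν : ν.HasUniqueBestAction) {a : Fin (n + 1)}
    (ha : ¬ ν.IsBestAction a) (T : ℕ) :
    alg.law ν (alg.stopsRecommendBy a T) ≤ ENNReal.ofReal δ := by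
  have hdisj : Disjoint {ω | ∃ t : ℕ, alg.stoppingTime ω = t ∧
      ν.rootValue - ν.actionValue (alg.recommend ω.1 (alg.history ω t)) ≤ 0}
      (alg.stopsRecommendBy a T) := by
    refine Set.disjoint_left.2 ?_
    rintro ω ⟨t, ht, hval⟩ ⟨hs, hrec⟩
    obtain ⟨t', -, ht', heq⟩ := alg.exists_stoppingTime_eq ω hs
    obtain rfl : t = t' := Nat.cast_injective (ht.symm.trans ht')
    rw [← heq, hrec] at hval
    exact ha ((ν.isBestAction_iff a).2 hval)
  -- Additivity needs measurability of the second event only, so none is required of the correctness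
  -- event.
  have h := (add_le_add_left (halg ν hν) (alg.law ν (alg.stopsRecommendBy a T))).trans
    ((measure_union hdisj (alg.measurableSet_stops_recommend T a)).symm.le.trans prob_le_one)
  have hsum : ENNReal.ofReal (1 - δ) + ENNReal.ofReal δ = 1 := by
    rw [← ENNReal.ofReal_add (by linarith) hδ0]; simp
  rw [← hsum] at h
  exact (ENNReal.add_le_add_iff_left ENNReal.ofReal_ne_top).1 h

lemma IsCorrect.le_iSup_law_stopsRecommendBy (halg : alg.IsCorrect 0 δ)
    {μ : MCTSModel child} (hμ : μ.HasUniqueBestAction) {a : Fin (n + 1)} (ha : μ.IsBestAction a) :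
    ENNReal.ofReal (1 - δ) ≤ ⨆ T, alg.law μ (alg.stopsRecommendBy a T) := by
  have hmono : Monotone (alg.stopsRecommendBy a) := by
    intro T T' hTT' ω ⟨hs, hrec⟩
    have heq := alg.stoppedHistory_of_le ω hTT' hs
    exact ⟨by rwa [heq], by rwa [heq]⟩
  rw [← hmono.measure_iUnion]
  refine (halg μ hμ).trans (measure_mono ?_)
  rintro ω ⟨t, ht, hval⟩
  obtain ⟨hs, heq⟩ := alg.stoppedHistory_of_stoppingTime_eq ω ht le_rfl
  refine Set.mem_iUnion.2 ⟨t, hs, ?_⟩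
  rw [heq]
  exact hμ.unique ((μ.isBestAction_iff _).2 hval) ha

/-- Here `ν` may have ties or means in `{0, 1}`, where neither correctness nor the change of measure
applies directly. Both are used at an interior model near `ν` whose unique best action is some `s ≠
a`. -/
lemma IsCorrect.mul_law_stopsRecommendBy_le_add_sum (halg : alg.IsCorrect 0 δ) (hδ0 : 0 < δ)
    (hδ : δ ≤ 1 / 2) {μ ν : MCTSModel child} {a : Fin (n + 1)} (ha : ¬ ν.IsBestAction a) (T : ℕ) :
    ENNReal.ofReal (2 * Real.log ((1 - δ) / δ)) * alg.law μ (alg.stopsRecommendBy a T) ≤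
      ENNReal.ofReal (Real.log ((1 - δ) / δ)) +
        ∑ l, alg.expectedCount μ T l * binaryKL (μ l) (ν l) := by
  set c := Real.log ((1 - δ) / δ)
  have hδ1 : 0 < 1 - δ := by linarith
  have hc0 : 0 ≤ c := Real.log_nonneg ((one_le_div hδ0).2 (by linarith))
  have hexp : Real.exp c = (1 - δ) / δ := Real.exp_log (by positivity)
  -- This identity dictates `c`: the exponential moment is exactly `1` when the event has
  -- probability `δ`.
  have hone : (Real.exp c - Real.exp (-c)) * δ + Real.exp (-c) = 1 := by
    rw [Real.exp_neg, hexp]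
    field_simp
    ring
  obtain ⟨s, hs⟩ := ν.exists_isBestAction
  have hsa : a ≠ s := fun h => ha (h ▸ hs)
  have key : ∀ η : ℝ, 0 < η →
      ENNReal.ofReal (2 * c) * alg.law μ (alg.stopsRecommendBy a T) ≤
        ENNReal.ofReal c + ∑ l, alg.expectedCount μ T l * binaryKL (μ l) (ν l) +
          (∑ l, alg.expectedCount μ T l) * ENNReal.ofReal η := by
    intro η hη
    -- Shrinking by `ε = 1 - exp (-η)` makes the extra divergence per sample `-log (1 - ε) = η`.
    have hε0 : 0 < 1 - Real.exp (-η) := sub_pos.2 (by simpa using hη)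
    have hε1 : 1 - Real.exp (-η) < 1 := by linarith [Real.exp_pos (-η)]
    obtain ⟨ν', h0, h1, hle, hle', hlt⟩ := ν.exists_interior_strictly_best hs hε0 hε1
    have hbest : ν'.IsBestAction s := fun s' => by
      rcases eq_or_ne s' s with rfl | h
      · exact le_rfl
      · exact (hlt s' h).le
    have huniq : ν'.HasUniqueBestAction := ⟨s, hbest, fun s' hs' => by
      by_contra h
      exact absurd (hs' s) (not_le.2 (hlt s' h))⟩
    have hq := halg.law_stopsRecommendBy_le hδ0.le (by linarith) huniq
      (fun h => absurd (h s) (not_le.2 (hlt a hsa))) T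
    have hmain := alg.change_of_measure μ ν' h0 h1 a hc0 T
    have hR : 0 ≤ Real.exp c - Real.exp (-c) := sub_nonneg.2 (Real.exp_le_exp.2 (by linarith))
    have hone' : ENNReal.ofReal (Real.exp c - Real.exp (-c)) *
        alg.law ν' (alg.stopsRecommendBy a T) + ENNReal.ofReal (Real.exp (-c)) ≤ 1 := by
      refine (add_le_add_left (mul_le_mul_right hq _) _).trans (le_of_eq ?_)
      rw [← ENNReal.ofReal_mul hR, ← ENNReal.ofReal_add (by positivity) (Real.exp_pos _).le, hone,
        ENNReal.ofReal_one]
    rw [add_assoc _ (_ * _) (ENNReal.ofReal (Real.exp (-c)))] at hmain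
    have hmain' := (ENNReal.add_le_add_iff_right ENNReal.one_ne_top).1
      (hmain.trans (add_le_add_right hone' _))
    refine hmain'.trans ?_
    rw [add_assoc]
    refine add_le_add_right ?_ _
    rw [Finset.sum_mul, ← Finset.sum_add_distrib]
    refine Finset.sum_le_sum fun l _ => ?_
    rw [← mul_add]
    refine mul_le_mul_right ?_ _
    have h := binaryKL_le_add_neg_log (μ l).2.1 (μ l).2.2 (ν l).2.1 (ν l).2.2 (h0 l) (h1 l) hε1
      (hle l) (hle' l)
    rwa [sub_sub_cancel, Real.log_exp, neg_neg] at h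
  -- The error vanishes as `η → 0` because the expected counts up to the fixed `T` are finite, even
  -- if `E_μ[τ] = ∞`.
  have hlim : Filter.Tendsto (fun η : ℝ => ENNReal.ofReal c +
      ∑ l, alg.expectedCount μ T l * binaryKL (μ l) (ν l) +
        (∑ l, alg.expectedCount μ T l) * ENNReal.ofReal η) (nhdsWithin 0 (Set.Ioi 0))
      (nhds (ENNReal.ofReal c + ∑ l, alg.expectedCount μ T l * binaryKL (μ l) (ν l) +
        (∑ l, alg.expectedCount μ T l) * ENNReal.ofReal 0)) :=
    (tendsto_const_nhds.add (ENNReal.Tendsto.const_mul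
      (ENNReal.continuous_ofReal.tendsto 0)
      (Or.inr (alg.sum_expectedCount_ne_top μ T)))).mono_left nhdsWithin_le_nhds
  have h := ge_of_tendsto hlim (Filter.eventually_of_mem self_mem_nhdsWithin key)
  simpa using h

end SearchAlgorithm

theorem theorem3 {n : ℕ} (child : Fin (n + 1) → GameTree) {S : Type*} [MeasurableSpace S]
    (δ : ℝ) (hδ0 : 0 < δ) (hδ : δ ≤ 1 / 2)
    (alg : SearchAlgorithm (GameTree.maxRoot child).Leaf (Fin (n + 1)) S)
    (halg : alg.IsCorrect 0 δ)
    (μ : MCTSModel child) (hμ : μ.HasUniqueBestAction) :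
    μ.charTime * binaryKL δ (1 - δ) ≤ alg.expectedSamples μ := by
  have := alg.isProbabilityMeasure_seedLaw
  have : Nonempty S := nonempty_of_isProbabilityMeasure alg.seedLaw
  have : Nonempty (maxRoot child).Leaf := ⟨alg.sample (Classical.arbitrary S) []⟩
  rcases μ.Alt.eq_empty_or_nonempty with hAlt | hAlt
  · rw [MCTSModel.charTime_eq_zero_of_alt_eq_empty hAlt, zero_mul]
    exact zero_le
  obtain ⟨a, ha⟩ := hμ.exists
  set c := Real.log ((1 - δ) / δ)
  have hc0 : 0 ≤ c := Real.log_nonneg ((one_le_div hδ0).2 (by linarith))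
  have hT : ∀ T, ENNReal.ofReal (2 * c) * alg.law μ (alg.stopsRecommendBy a T) ≤
      ENNReal.ofReal c + alg.expectedSamples μ * μ.invCharTime := by
    intro T
    -- The constant `c` moves to the left by truncated subtraction, leaving a bound uniform in `ν`
    -- to which the characteristic time applies.
    rw [← tsub_le_iff_left]
    refine (MCTSModel.le_mul_invCharTime hAlt (alg.sum_expectedCount_ne_top μ T)
      fun ν hν => tsub_le_iff_left.2 ?_).trans
      (mul_le_mul_left (alg.sum_expectedCount_le_expectedSamples μ T) _)
    exact halg.mul_law_stopsRecommendBy_le_add_sum hδ0 hδ (hν a ha) T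
  have hlim : ENNReal.ofReal (2 * c) * ENNReal.ofReal (1 - δ) ≤
      ENNReal.ofReal c + alg.expectedSamples μ * μ.invCharTime := by
    refine (mul_le_mul_right (halg.le_iSup_law_stopsRecommendBy hμ ha) _).trans ?_
    rw [ENNReal.mul_iSup]
    exact iSup_le hT
  -- The left side becomes `2 c (1 - δ) - c = (1 - 2 δ) c`, which is `d(δ, 1 - δ)`.
  rw [← ENNReal.ofReal_mul (by positivity), ← tsub_le_iff_left, ← ENNReal.ofReal_sub _ hc0] at hlim
  rw [binaryKL_one_sub hδ0 (by linarith), mul_comm, MCTSModel.charTime, ← div_eq_mul_inv]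
  refine ENNReal.div_le_of_le_mul (le_trans (le_of_eq ?_) hlim)
  congr 1
  ring
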